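/- Let $k\ge 0$ and $p\ge 2$ be integers and let $\alpha>0$ be real. Let $\mathbf G_\alpha$ be a $k\times(k+p)$ random matrix whose entries are independent real Gaussian random variables with distribution $\mathcal N(0,\alpha)$ (mean $0$ and variance $\alpha$), and regard $\mathbf G_\alpha$ as a matrix over $\mathbb K$, where $\mathbb K=\mathbb R$ or $\mathbb K=\mathbb C$. Let $\mathbf G_\alpha^\dagger$ denote its Moore–Penrose pseudo-inverse over $\mathbb K$, and let $\|\cdot\|_F$ be the Frobenius norm. Then $\|\mathbf G_\alpha^\dagger\|_F^2$ is integrable and $$\mathbb E\,\|\mathbf G_\alpha^\dagger\|_F^2=\frac{k}{p-1}\cdot\alpha^{-1}.$$ -/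

import Mathlib

open MeasureTheory ProbabilityTheory
open scoped NNReal Matrix Matrix.Norms.Frobenius

/-- `B` is the Moore–Penrose pseudo-inverse of `A`: the four Penrose equations. -/
structure IsMoorePenroseInverse {m n 𝕜 : Type*} [Fintype m] [Fintype n] [RCLike 𝕜]
    (A : Matrix m n 𝕜) (B : Matrix n m 𝕜) : Prop where
  mul_mul_self : A * B * A = A
  mul_mul_inv : B * A * B = B
  isHermitian_mul : (A * B).IsHermitian
  isHermitian_mul' : (B * A).IsHermitian

open scoped ComplexOrder in
/-- Every real or complex matrix has a Moore–Penrose pseudo-inverse. -/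
theorem exists_isMoorePenroseInverse {m n 𝕜 : Type*} [Fintype m] [Fintype n] [RCLike 𝕜]
    (A : Matrix m n 𝕜) : ∃ B : Matrix n m 𝕜, IsMoorePenroseInverse A B := by
  classical
  have hH : (Aᴴ * A).IsHermitian := Matrix.isHermitian_conjTranspose_mul_self A
  -- a Hermitian pseudo-inverse of `Aᴴ * A`, from its spectral decomposition
  obtain ⟨K, hK, hHK, hKHK, hHKH⟩ : ∃ K : Matrix n n 𝕜, Kᴴ = K ∧
      (K * (Aᴴ * A))ᴴ = K * (Aᴴ * A) ∧ K * (Aᴴ * A) * K = K ∧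
      (Aᴴ * A) * K * (Aᴴ * A) = Aᴴ * A := by
    obtain ⟨U, d, hU, hd⟩ : ∃ (U : Matrix n n 𝕜) (d : n → ℝ), Uᴴ * U = 1 ∧
        Aᴴ * A = U * Matrix.diagonal (fun i => (d i : 𝕜)) * Uᴴ := by
      refine ⟨hH.eigenvectorUnitary, hH.eigenvalues, ?_, ?_⟩
      · exact Unitary.coe_star_mul_self hH.eigenvectorUnitary
      · exact hH.spectral_theorem
    have key : ∀ X Y : Matrix n n 𝕜, (U * X * Uᴴ) * (U * Y * Uᴴ) = U * (X * Y) * Uᴴ := by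
      intro X Y
      calc (U * X * Uᴴ) * (U * Y * Uᴴ) = U * X * (Uᴴ * U) * Y * Uᴴ := by
            simp only [Matrix.mul_assoc]
        _ = U * (X * Y) * Uᴴ := by rw [hU]; simp only [Matrix.mul_one, Matrix.mul_assoc]
    have herm : ∀ f : n → ℝ, (U * Matrix.diagonal (fun i => (f i : 𝕜)) * Uᴴ)ᴴ
        = U * Matrix.diagonal (fun i => (f i : 𝕜)) * Uᴴ := by
      intro f
      have : star (fun i => (f i : 𝕜)) = fun i => (f i : 𝕜) := by
        funext i; simp
      simp [Matrix.conjTranspose_mul, Matrix.diagonal_conjTranspose, this, Matrix.mul_assoc]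
    have hz : ∀ i, (d i : 𝕜)⁻¹ * (d i : 𝕜) = (((d i)⁻¹ * d i : ℝ) : 𝕜) := by
      intro i; push_cast; rfl
    refine ⟨U * Matrix.diagonal (fun i => (((d i)⁻¹ : ℝ) : 𝕜)) * Uᴴ, herm _, ?_, ?_, ?_⟩
    · rw [hd, key, Matrix.diagonal_mul_diagonal]
      have := herm (fun i => (d i)⁻¹ * d i)
      simpa using this
    · rw [hd, key, key, Matrix.diagonal_mul_diagonal, Matrix.diagonal_mul_diagonal]
      congr 3
      funext i
      by_cases h : d i = 0 <;> simp [h]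
    · rw [hd, key, key, Matrix.diagonal_mul_diagonal, Matrix.diagonal_mul_diagonal]
      congr 3
      funext i
      by_cases h : d i = 0 <;> simp [h]
  have hAKA : A * (K * (Aᴴ * A)) = A := by
    have h0 : A * (1 - K * (Aᴴ * A)) = 0 := by
      rw [← Matrix.conjTranspose_mul_self_eq_zero]
      have h1 : Aᴴ * A * (1 - K * (Aᴴ * A)) = 0 := by
        rw [Matrix.mul_sub, Matrix.mul_one, ← Matrix.mul_assoc (Aᴴ * A), hHKH, sub_self]
      rw [Matrix.conjTranspose_mul, Matrix.mul_assoc, ← Matrix.mul_assoc Aᴴ, h1, Matrix.mul_zero]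
    rw [Matrix.mul_sub, Matrix.mul_one, sub_eq_zero] at h0
    exact h0.symm
  refine ⟨K * Aᴴ, ?_, ?_, ?_, ?_⟩
  · simpa only [Matrix.mul_assoc] using hAKA
  · calc K * Aᴴ * A * (K * Aᴴ) = K * (Aᴴ * A) * K * Aᴴ := by simp only [Matrix.mul_assoc]
      _ = K * Aᴴ := by rw [hKHK]
  · simp [Matrix.IsHermitian, Matrix.conjTranspose_mul, hK, Matrix.mul_assoc]
  · rw [Matrix.IsHermitian, Matrix.mul_assoc]; exact hHK

/-- The Moore–Penrose pseudo-inverse is unique. -/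
theorem IsMoorePenroseInverse.unique {m n 𝕜 : Type*} [Fintype m] [Fintype n] [RCLike 𝕜]
    {A : Matrix m n 𝕜} {B C : Matrix n m 𝕜}
    (hB : IsMoorePenroseInverse A B) (hC : IsMoorePenroseInverse A C) : B = C := by
  have h1 : A * B = A * C := by
    calc A * B = (A * C * A) * B := by rw [hC.mul_mul_self]
      _ = (A * C)ᴴ * (A * B)ᴴ := by
          rw [hC.isHermitian_mul.eq, hB.isHermitian_mul.eq]; simp only [Matrix.mul_assoc]
      _ = ((A * B * A) * C)ᴴ := by
          rw [← Matrix.conjTranspose_mul]; simp only [Matrix.mul_assoc]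
      _ = A * C := by rw [hB.mul_mul_self, hC.isHermitian_mul.eq]
  have h2 : B * A = C * A := by
    calc B * A = B * (A * C * A) := by rw [hC.mul_mul_self]
      _ = (B * A)ᴴ * (C * A)ᴴ := by
          rw [hC.isHermitian_mul'.eq, hB.isHermitian_mul'.eq]; simp only [Matrix.mul_assoc]
      _ = (C * (A * B * A))ᴴ := by
          rw [← Matrix.conjTranspose_mul]; simp only [Matrix.mul_assoc]
      _ = C * A := by rw [hB.mul_mul_self, hC.isHermitian_mul'.eq]
  calc B = B * A * B := hB.mul_mul_inv.symm
    _ = C * (A * B) := by rw [h2, Matrix.mul_assoc]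
    _ = C * A * C := by rw [h1, Matrix.mul_assoc]
    _ = C := hC.mul_mul_inv

/-- The Moore–Penrose pseudo-inverse `A†` of a real or complex matrix. -/
noncomputable def pinv {m n 𝕜 : Type*} [Fintype m] [Fintype n] [RCLike 𝕜]
    (A : Matrix m n 𝕜) : Matrix n m 𝕜 :=
  Classical.choose (exists_isMoorePenroseInverse A)

theorem isMoorePenroseInverse_pinv {m n 𝕜 : Type*} [Fintype m] [Fintype n] [RCLike 𝕜]
    (A : Matrix m n 𝕜) : IsMoorePenroseInverse A (pinv A) :=
  Classical.choose_spec (exists_isMoorePenroseInverse A)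

/-- `G` is an `N(0, α)`-Gaussian random matrix: its entries are independent real random variables,
each with the normal distribution of mean `0` and variance `α`. -/
structure IsGaussianMatrix {Ω m n : Type*} [MeasurableSpace Ω] (P : Measure Ω) (α : ℝ≥0)
    (G : Ω → Matrix m n ℝ) : Prop where
  hasLaw : ∀ i j, HasLaw (fun ω => G ω i j) (gaussianReal 0 α) P
  indep : iIndepFun (fun (ij : m × n) ω => G ω ij.1 ij.2) P

/-! Rescaling by `(√α)⁻¹` reduces to unit variance. The rows of `G` are then independent standard
Gaussian vectors, almost surely linearly independent, so `‖G†‖² = tr (G Gᵀ)⁻¹`, the sum of the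
diagonal entries of an inverse Gram matrix. The `i`-th entry is the inverse squared distance from
row `i` to the span of the others (`gram_inv_apply_self_of_linearIndependent`). Given the other
rows, this distance is the norm of a standard Gaussian vector in a space of dimension `d = p + 1`,
whose inverse square has mean `1 / (d - 2) = 1 / (p - 1)`. Summing over the `k` rows gives the
claim. -/

/-! ### Mean of the inverse of a chi-squared variable. -/

theorem lintegral_exp_neg_mul_Ioi (s : ℝ) (hs : 0 ≤ s) :
    ∫⁻ t in Set.Ioi (0 : ℝ), ENNReal.ofReal (Real.exp (-t * s)) = (ENNReal.ofReal s)⁻¹ := by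
  rcases hs.eq_or_lt with rfl | hs
  -- At `s = 0` the integrand is `1` and both sides are `∞`.
  · simp
  · have h := integral_exp_mul_Ioi (neg_lt_zero.2 hs) 0
    have hi := integrableOn_exp_mul_Ioi (neg_lt_zero.2 hs) 0
    have he : ∀ t : ℝ, -t * s = -s * t := fun t => by ring
    simp only [he]
    rw [← ofReal_integral_eq_lintegral_ofReal hi (.of_forall fun _ => (Real.exp_pos _).le), h,
      ← ENNReal.ofReal_inv_of_pos hs]
    congr 1
    simp [neg_div_neg_eq]

theorem integral_exp_neg_mul_sq_gaussianReal {t : ℝ} (ht : 0 < t) :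
    ∫ x, Real.exp (-t * x ^ 2) ∂(gaussianReal 0 1) = (1 + 2 * t) ^ (-(1 / 2) : ℝ) := by
  rw [integral_gaussianReal_eq_integral_smul one_ne_zero]
  have h : ∀ x : ℝ, gaussianPDFReal 0 1 x • Real.exp (-t * x ^ 2)
      = (√(2 * Real.pi))⁻¹ * Real.exp (-(t + 1 / 2) * x ^ 2) := by
    intro x
    simp only [gaussianPDFReal, NNReal.coe_one, mul_one, sub_zero, smul_eq_mul]
    rw [mul_assoc, ← Real.exp_add]
    congr 2
    ring
  simp only [h]
  rw [integral_const_mul, integral_gaussian, Real.rpow_neg (by positivity), ← Real.sqrt_eq_rpow,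
    ← Real.sqrt_inv, ← Real.sqrt_inv, ← Real.sqrt_mul (by positivity)]
  congr 1
  have := Real.pi_ne_zero
  field_simp
  ring

theorem lintegral_one_add_two_mul_rpow_Ioi {d : ℝ} (hd : 2 < d) :
    ∫⁻ t in Set.Ioi (0 : ℝ), ENNReal.ofReal ((1 + 2 * t) ^ (-(d / 2)))
      = ENNReal.ofReal (1 / (d - 2)) := by
  have hd2 : d - 2 ≠ 0 := by linarith
  have hderiv : ∀ x ∈ Set.Ici (0 : ℝ),
      HasDerivAt (fun t : ℝ => -(1 / (d - 2)) * (1 + 2 * t) ^ (1 - d / 2))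
        ((1 + 2 * x) ^ (-(d / 2))) x := by
    intro x hx
    have hx : (0 : ℝ) ≤ x := hx
    have h1 : HasDerivAt (fun t : ℝ => 1 + 2 * t) 2 x := by
      simpa using ((hasDerivAt_id x).const_mul 2).const_add 1
    have h2 := (h1.rpow_const (p := 1 - d / 2) (Or.inl (by positivity))).const_mul
      (-(1 / (d - 2)))
    refine h2.congr_deriv ?_
    rw [show (1 - d / 2 - 1 : ℝ) = -(d / 2) by ring]
    field_simp
    ring
  have hpos : ∀ x ∈ Set.Ioi (0 : ℝ), 0 ≤ (1 + 2 * x) ^ (-(d / 2)) := fun x hx => by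
    have hx : (0 : ℝ) < x := hx
    positivity
  have hlim : Filter.Tendsto (fun t : ℝ => -(1 / (d - 2)) * (1 + 2 * t) ^ (1 - d / 2))
      Filter.atTop (nhds 0) := by
    have h3 : Filter.Tendsto (fun t : ℝ => 1 + 2 * t) Filter.atTop Filter.atTop :=
      Filter.tendsto_atTop_add_const_left _ _
        (Filter.tendsto_id.const_mul_atTop (by norm_num : (0 : ℝ) < 2))
    have h4 := (tendsto_rpow_neg_atTop (y := d / 2 - 1) (by linarith)).comp h3
    have h5 := h4.const_mul (-(1 / (d - 2)))
    simpa [Function.comp_def] using h5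
  have hint := integrableOn_Ioi_deriv_of_nonneg' hderiv hpos hlim
  have h := integral_Ioi_of_hasDerivAt_of_nonneg' hderiv hpos hlim
  rw [← ofReal_integral_eq_lintegral_ofReal hint
    ((ae_restrict_iff' measurableSet_Ioi).2 (.of_forall hpos)), h]
  simp

/-- Write `1 / s` as `∫ exp (-t s) dt` over `t > 0` and apply Tonelli. For fixed `t` the Gaussian
integral factors over coordinates into `(1 + 2 t) ^ (-d / 2)`, integrable at infinity because `d >
2`. -/
theorem lintegral_inv_sum_sq_pi_gaussianReal {d : ℕ} (hd : 3 ≤ d) :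
    ∫⁻ x : Fin d → ℝ, (ENNReal.ofReal (∑ i, x i ^ 2))⁻¹ ∂(Measure.pi fun _ => gaussianReal 0 1)
      = ENNReal.ofReal (1 / ((d : ℝ) - 2)) := by
  have h1 : ∀ x : Fin d → ℝ, (ENNReal.ofReal (∑ i, x i ^ 2))⁻¹
      = ∫⁻ t in Set.Ioi (0 : ℝ), ENNReal.ofReal (Real.exp (-t * ∑ i, x i ^ 2)) := fun x =>
    (lintegral_exp_neg_mul_Ioi _ (Finset.sum_nonneg fun i _ => sq_nonneg _)).symm
  simp only [h1]
  rw [lintegral_lintegral_swap (by fun_prop)]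
  have h2 : (2 : ℝ) < d := by exact_mod_cast hd
  rw [← lintegral_one_add_two_mul_rpow_Ioi h2]
  refine setLIntegral_congr_fun measurableSet_Ioi fun t ht => ?_
  have ht : (0 : ℝ) < t := ht
  have hpos : ∀ x : Fin d → ℝ, 0 ≤ ∑ i, x i ^ 2 := fun x =>
    Finset.sum_nonneg fun i _ => sq_nonneg _
  have hint : Integrable (fun x : Fin d → ℝ => Real.exp (-t * ∑ i, x i ^ 2))
      (Measure.pi fun _ => gaussianReal 0 1) := by
    refine Integrable.of_bound (C := 1) (Measurable.aestronglyMeasurable (by fun_prop)) (.of_forall fun x => ?_)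
    rw [Real.norm_eq_abs, Real.abs_exp, Real.exp_le_one_iff]
    nlinarith [hpos x]
  rw [← ofReal_integral_eq_lintegral_ofReal hint (.of_forall fun _ => (Real.exp_pos _).le)]
  congr 1
  simp only [Finset.mul_sum, Real.exp_sum]
  rw [integral_fintype_prod_eq_pow (ι := Fin d) (fun y : ℝ => Real.exp (-t * y ^ 2)),
    integral_exp_neg_mul_sq_gaussianReal ht, Fintype.card_fin, ← Real.rpow_mul_natCast (by positivity)]
  congr 1
  ring

/-! ### Orthogonal projections of a standard Gaussian vector. -/

section

variable {E : Type*} [NormedAddCommGroup E] [InnerProductSpace ℝ E] [FiniteDimensional ℝ E]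
  [MeasurableSpace E] [BorelSpace E]

theorem lintegral_inv_norm_sq_stdGaussian (hd : 3 ≤ Module.finrank ℝ E) :
    ∫⁻ x, (ENNReal.ofReal (‖x‖ ^ 2))⁻¹ ∂(stdGaussian E)
      = ENNReal.ofReal (1 / ((Module.finrank ℝ E : ℝ) - 2)) := by
  rw [← lintegral_inv_sum_sq_pi_gaussianReal hd, stdGaussian,
    lintegral_map (by fun_prop) (by fun_prop)]
  refine lintegral_congr fun x => ?_
  have h : ‖∑ i, x i • stdOrthonormalBasis ℝ E i‖ ^ 2 = ∑ i, x i ^ 2 := by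
    rw [← (stdOrthonormalBasis ℝ E).sum_sq_norm_inner_right]
    refine Finset.sum_congr rfl fun i _ => ?_
    rw [(stdOrthonormalBasis ℝ E).orthonormal.inner_right_fintype, Real.norm_eq_abs, sq_abs]
  rw [h]

/-- The characteristic functions agree: for `t ∈ K`, pairing with `t` does not see the projection.
-/
theorem stdGaussian_map_orthogonalProjection (K : Submodule ℝ E) :
    (stdGaussian E).map K.orthogonalProjectionOnto = stdGaussian K := by
  apply Measure.ext_of_charFun
  ext t
  rw [charFun_apply, integral_map (by fun_prop) (by fun_prop), charFun_stdGaussian]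
  have h := charFun_stdGaussian (t : E)
  rw [charFun_apply] at h
  simpa only [← Submodule.inner_orthogonalProjectionOnto_eq_of_mem_right t,
    Submodule.coe_norm] using h

theorem lintegral_inv_norm_sq_orthogonalProjection_stdGaussian (K : Submodule ℝ E)
    (hd : 3 ≤ Module.finrank ℝ K) :
    ∫⁻ x, (ENNReal.ofReal (‖K.orthogonalProjectionOnto x‖ ^ 2))⁻¹ ∂(stdGaussian E)
      = ENNReal.ofReal (1 / ((Module.finrank ℝ K : ℝ) - 2)) := by
  rw [← lintegral_inv_norm_sq_stdGaussian hd, ← stdGaussian_map_orthogonalProjection K,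
    lintegral_map (by fun_prop) (by fun_prop)]

end

/-! ### Splitting one coordinate off a product measure. -/

section

variable {X : Type*} [MeasurableSpace X] {μ : Measure X} [SigmaFinite μ] {k : ℕ}

theorem measurePreserving_insertNth_pi (i : Fin (k + 1)) :
    MeasurePreserving (fun z : (Fin k → X) × X => (i.insertNth z.2 z.1 : Fin (k + 1) → X))
      ((Measure.pi fun _ => μ).prod μ) (Measure.pi fun _ => μ) :=
  (measurePreserving_piFinSuccAbove (fun _ : Fin (k + 1) => μ) i).symm.comp
    Measure.measurePreserving_swap

theorem ae_pi_iff_ae_ae_insertNth (i : Fin (k + 1)) {q : (Fin (k + 1) → X) → Prop}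
    (hq : MeasurableSet {v | q v}) :
    (∀ᵐ v ∂(Measure.pi fun _ => μ), q v) ↔
      ∀ᵐ w ∂(Measure.pi fun _ => μ), ∀ᵐ x ∂μ, q (i.insertNth x w) := by
  have h := measurePreserving_insertNth_pi (μ := μ) i
  rw [← h.map_eq, ae_map_iff h.measurable.aemeasurable hq]
  exact Measure.ae_prod_iff_ae_ae (h.measurable hq)

theorem lintegral_pi_eq_lintegral_lintegral_insertNth (i : Fin (k + 1))
    {f : (Fin (k + 1) → X) → ENNReal} (hf : Measurable f) :
    ∫⁻ v, f v ∂(Measure.pi fun _ => μ)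
      = ∫⁻ w, ∫⁻ x, f (i.insertNth x w) ∂μ ∂(Measure.pi fun _ => μ) := by
  have h := measurePreserving_insertNth_pi (μ := μ) i
  rw [← h.lintegral_comp hf]
  exact lintegral_prod _ (hf.comp h.measurable).aemeasurable

end

/-! ### Inverse Gram matrices of Gaussian vectors. -/

section

variable {E : Type*} [NormedAddCommGroup E] [InnerProductSpace ℝ E]

open Matrix in
-- The component `w` of `v i` orthogonal to the other vectors is a combination `∑ c j • v j` with `c
-- i = 1`. Pairing it with each `v j` shows that the Gram matrix sends `c` to `‖w‖²` times the
-- `i`-th basis vector; invert and read off coordinate `i`.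
theorem gram_inv_apply_self_of_linearIndependent [FiniteDimensional ℝ E] {k : ℕ}
    {v : Fin (k + 1) → E} (hv : LinearIndependent ℝ v) (i : Fin (k + 1)) :
    (gram ℝ v)⁻¹ i i
      = (‖(Submodule.span ℝ (Set.range (v ∘ i.succAbove)))ᗮ.orthogonalProjectionOnto (v i)‖ ^ 2)⁻¹ := by
  set W := Submodule.span ℝ (Set.range (v ∘ i.succAbove)) with hW
  set w : E := Wᗮ.orthogonalProjectionOnto (v i) with hw
  have hwW : w ∈ Wᗮ := (Wᗮ.orthogonalProjectionOnto (v i)).2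
  have hmem : v i - w ∈ W := by
    have := Wᗮ.sub_starProjection_mem_orthogonal (v i)
    rwa [Submodule.orthogonal_orthogonal] at this
  obtain ⟨a, ha⟩ := (Submodule.mem_span_range_iff_exists_fun ℝ).1 hmem
  set c : Fin (k + 1) → ℝ := i.insertNth 1 (-a) with hc
  have hcw : ∑ j, c j • v j = w := by
    rw [Fin.sum_univ_succAbove _ i]
    have : ∑ j, a j • v (i.succAbove j) = v i - w := ha
    simp [hc, this]
  have hinner : inner ℝ (v i) w = ‖w‖ ^ 2 := by
    have h := Submodule.inner_right_of_mem_orthogonal hmem hwW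
    rw [inner_sub_left, real_inner_self_eq_norm_sq] at h
    linarith
  have hgram : gram ℝ v *ᵥ c = ‖w‖ ^ 2 • Pi.single i 1 := by
    ext j
    have h1 : (gram ℝ v *ᵥ c) j = inner ℝ (v j) w := by
      rw [← hcw, inner_sum]
      simp [mulVec, dotProduct, inner_smul_right, mul_comm]
    rw [h1]
    obtain rfl | ⟨l, rfl⟩ := i.eq_self_or_eq_succAbove j
    · simp [hinner]
    · have : v (i.succAbove l) ∈ W := Submodule.subset_span ⟨l, rfl⟩
      simp [Submodule.inner_right_of_mem_orthogonal this hwW]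
  have hdet : IsUnit (gram ℝ v).det := (det_gram_ne_zero_iff_linearIndependent.2 hv).isUnit
  have h : c = (gram ℝ v)⁻¹ *ᵥ (‖w‖ ^ 2 • Pi.single i 1) := by
    rw [← hgram, mulVec_mulVec, nonsing_inv_mul _ hdet, one_mulVec]
  have hi := congrFun h i
  rw [mulVec_smul, mulVec_single_one] at hi
  simp only [hc, Fin.insertNth_apply_same, Pi.smul_apply, smul_eq_mul, col_apply] at hi
  exact eq_inv_of_mul_eq_one_right hi.symm

variable [MeasurableSpace E] [BorelSpace E] [FiniteDimensional ℝ E]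

open Matrix in
theorem measurable_gram_det {k : ℕ} : Measurable fun v : Fin k → E => (gram ℝ v).det := by
  apply Continuous.measurable
  refine Continuous.matrix_det (continuous_matrix fun i j => ?_)
  simp only [gram_apply]
  fun_prop

open Matrix in
theorem measurable_gram_inv_apply {k : ℕ} (i j : Fin k) :
    Measurable fun v : Fin k → E => (gram ℝ v)⁻¹ i j := by
  simp only [Matrix.inv_def, Ring.inverse_eq_inv', Matrix.smul_apply, smul_eq_mul]
  refine measurable_gram_det.inv.mul (Continuous.measurable ?_)
  refine Continuous.matrix_elem (Continuous.matrix_adjugate (continuous_matrix fun i j => ?_)) i j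
  simp only [gram_apply]
  fun_prop

open Matrix in
theorem measurableSet_linearIndependent {k : ℕ} :
    MeasurableSet {v : Fin k → E | LinearIndependent ℝ v} := by
  simp only [← det_gram_ne_zero_iff_linearIndependent]
  exact measurable_gram_det (measurableSet_singleton 0).compl

omit [MeasurableSpace E] [BorelSpace E] in
theorem three_le_finrank_span_orthogonal {k p : ℕ} (hp : 2 ≤ p)
    (hE : Module.finrank ℝ E = k + 1 + p) (v : Fin k → E) :
    3 ≤ Module.finrank ℝ (Submodule.span ℝ (Set.range v))ᗮ := by
  have h1 := (Submodule.span ℝ (Set.range v)).finrank_add_finrank_orthogonal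
  have h2 := finrank_range_le_card (R := ℝ) v
  rw [Set.finrank, Fintype.card_fin] at h2
  omega

/-- On `W` the inverse squared norm of the projection to `Wᗮ` is `∞`, yet its integral is finite. -/
theorem ae_notMem_stdGaussian (W : Submodule ℝ E) (hW : 3 ≤ Module.finrank ℝ Wᗮ) :
    ∀ᵐ x ∂(stdGaussian E), x ∉ W := by
  have h := lintegral_inv_norm_sq_orthogonalProjection_stdGaussian Wᗮ hW
  have h2 := ae_lt_top (μ := stdGaussian E) (by fun_prop) (h.trans_ne ENNReal.ofReal_ne_top)
  filter_upwards [h2] with x hx hxW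
  have h0 : Wᗮ.orthogonalProjectionOnto x = 0 := by
    rw [Submodule.orthogonalProjectionOnto_eq_zero_iff, Submodule.orthogonal_orthogonal]
    exact hxW
  simp [h0] at hx

theorem ae_linearIndependent_pi_stdGaussian {k p : ℕ} (hp : 2 ≤ p)
    (hE : Module.finrank ℝ E = k + p) :
    ∀ᵐ v ∂(Measure.pi fun _ : Fin k => stdGaussian E), LinearIndependent ℝ v := by
  induction k generalizing p with
  | zero => exact .of_forall fun v => linearIndependent_empty_type
  | succ k ih =>
    rw [ae_pi_iff_ae_ae_insertNth 0 measurableSet_linearIndependent]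
    -- The ambient space is fixed, so one vector fewer means codimension `p + 1`.
    filter_upwards [ih (p := p + 1) (by omega) (by omega)] with v hv
    filter_upwards [ae_notMem_stdGaussian _ (three_le_finrank_span_orthogonal hp hE v)] with x hx
    rw [Fin.insertNth_zero]
    exact linearIndependent_finCons.2 ⟨hv, hx⟩

open Matrix in
theorem lintegral_gram_inv_apply_self {k p : ℕ} (hp : 2 ≤ p)
    (hE : Module.finrank ℝ E = k + p) (i : Fin k) :
    ∫⁻ v, ENNReal.ofReal ((gram ℝ v)⁻¹ i i) ∂(Measure.pi fun _ : Fin k => stdGaussian E)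
      = ENNReal.ofReal (1 / ((p : ℝ) - 1)) := by
  obtain _ | k := k
  · exact i.elim0
  have hli := ae_linearIndependent_pi_stdGaussian hp hE
  rw [ae_pi_iff_ae_ae_insertNth i measurableSet_linearIndependent] at hli
  rw [lintegral_pi_eq_lintegral_lintegral_insertNth i
    (measurable_gram_inv_apply i i).ennreal_ofReal]
  -- For almost every choice of the other vectors the inner integral is the same constant: it
  -- depends only on the dimension `p + 1` of their orthogonal complement.
  rw [lintegral_congr_ae (g := fun _ => ENNReal.ofReal (1 / ((p : ℝ) - 1)))]
  · simp
  filter_upwards [hli] with v hv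
  have hv' : LinearIndependent ℝ v := by
    obtain ⟨x, hx⟩ := hv.exists
    have := hx.comp i.succAbove i.succAbove_right_injective
    rwa [Fin.insertNth_comp_succAbove] at this
  have hfin : Module.finrank ℝ (Submodule.span ℝ (Set.range v))ᗮ = p + 1 := by
    have h1 := (Submodule.span ℝ (Set.range v)).finrank_add_finrank_orthogonal
    rw [finrank_span_eq_card hv', Fintype.card_fin] at h1
    omega
  have h := lintegral_inv_norm_sq_orthogonalProjection_stdGaussian
    (Submodule.span ℝ (Set.range v))ᗮ (by omega)
  rw [hfin] at h
  have h3 : ((p + 1 : ℕ) : ℝ) - 2 = p - 1 := by push_cast; ring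
  rw [h3] at h
  rw [← h]
  refine lintegral_congr_ae ?_
  filter_upwards [hv, ae_notMem_stdGaussian _ (by omega : 3 ≤
    Module.finrank ℝ (Submodule.span ℝ (Set.range v))ᗮ)] with x hx hxW
  have hg := gram_inv_apply_self_of_linearIndependent hx i
  rw [Fin.insertNth_comp_succAbove, Fin.insertNth_apply_same] at hg
  rw [hg, ENNReal.ofReal_inv_of_pos]
  have : (Submodule.span ℝ (Set.range v))ᗮ.orthogonalProjectionOnto x ≠ 0 := by
    rwa [Ne, Submodule.orthogonalProjectionOnto_eq_zero_iff, Submodule.orthogonal_orthogonal]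
  positivity

end

/-! ### Algebra of the pseudo-inverse and its Frobenius norm. -/

theorem pinv_eq {m n 𝕜 : Type*} [Fintype m] [Fintype n] [RCLike 𝕜] {A : Matrix m n 𝕜}
    {B : Matrix n m 𝕜} (h : IsMoorePenroseInverse A B) : pinv A = B :=
  (isMoorePenroseInverse_pinv A).unique h

theorem pinv_map_algebraMap {m n 𝕜 : Type*} [Fintype m] [Fintype n] [RCLike 𝕜]
    (A : Matrix m n ℝ) :
    pinv (A.map (algebraMap ℝ 𝕜)) = (pinv A).map (algebraMap ℝ 𝕜) := by
  have h := isMoorePenroseInverse_pinv A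
  have hstar : Function.Semiconj (algebraMap ℝ 𝕜) star star := fun x => by simp
  apply pinv_eq
  constructor
  · rw [← Matrix.map_mul, ← Matrix.map_mul, h.mul_mul_self]
  · rw [← Matrix.map_mul, ← Matrix.map_mul, h.mul_mul_inv]
  · rw [← Matrix.map_mul]
    exact h.isHermitian_mul.map _ hstar
  · rw [← Matrix.map_mul]
    exact h.isHermitian_mul'.map _ hstar

theorem norm_pinv_map_algebraMap {m n 𝕜 : Type*} [Fintype m] [Fintype n] [RCLike 𝕜]
    (A : Matrix m n ℝ) : ‖pinv (A.map (algebraMap ℝ 𝕜))‖ = ‖pinv A‖ := by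
  rw [pinv_map_algebraMap]
  exact Matrix.frobenius_norm_map_eq _ _ fun a => by simp

theorem pinv_smul {m n 𝕜 : Type*} [Fintype m] [Fintype n] [RCLike 𝕜]
    {c : ℝ} (hc : c ≠ 0) (A : Matrix m n 𝕜) : pinv (c • A) = c⁻¹ • pinv A := by
  have h := isMoorePenroseInverse_pinv A
  apply pinv_eq
  constructor
  · simp [smul_smul, hc, h.mul_mul_self]
  · simp [smul_smul, hc, h.mul_mul_inv]
  · simpa [smul_smul, hc] using h.isHermitian_mul
  · simpa [smul_smul, hc] using h.isHermitian_mul'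

theorem pinv_eq_transpose_mul_inv {m n : Type*} [Fintype m] [Fintype n] [DecidableEq m]
    {A : Matrix m n ℝ} (hA : IsUnit (A * Aᵀ).det) : pinv A = Aᵀ * (A * Aᵀ)⁻¹ := by
  have h1 : A * (Aᵀ * (A * Aᵀ)⁻¹) = 1 := by
    rw [← Matrix.mul_assoc, Matrix.mul_nonsing_inv _ hA]
  apply pinv_eq
  constructor
  · rw [h1, Matrix.one_mul]
  · rw [Matrix.mul_assoc, h1, Matrix.mul_one]
  · rw [h1]
    exact Matrix.isHermitian_one
  · simp only [Matrix.IsHermitian, Matrix.conjTranspose_eq_transpose_of_trivial,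
      Matrix.transpose_mul, Matrix.transpose_transpose, Matrix.transpose_nonsing_inv,
      Matrix.mul_assoc]

theorem frobenius_norm_sq_eq_trace {m n : Type*} [Fintype m] [Fintype n] (A : Matrix m n ℝ) :
    ‖A‖ ^ 2 = (Aᵀ * A).trace := by
  have h : 0 ≤ ∑ i, ∑ j, ‖A i j‖ ^ (2 : ℝ) := by positivity
  rw [Matrix.frobenius_norm_def, ← Real.sqrt_eq_rpow, Real.sq_sqrt h, Finset.sum_comm]
  simp [Matrix.trace, Matrix.mul_apply, sq]

theorem norm_sq_pinv_eq_trace {m n : Type*} [Fintype m] [Fintype n] [DecidableEq m]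
    {A : Matrix m n ℝ} (hA : IsUnit (A * Aᵀ).det) : ‖pinv A‖ ^ 2 = (A * Aᵀ)⁻¹.trace := by
  rw [frobenius_norm_sq_eq_trace, pinv_eq_transpose_mul_inv hA]
  congr 1
  simp only [Matrix.transpose_mul, Matrix.transpose_transpose, Matrix.transpose_nonsing_inv]
  rw [Matrix.mul_assoc, ← Matrix.mul_assoc A, Matrix.mul_nonsing_inv _ hA, Matrix.mul_one]

theorem mul_transpose_eq_gram {m n : Type*} [Fintype n] (A : Matrix m n ℝ) :
    A * Aᵀ = Matrix.gram ℝ fun i => WithLp.toLp 2 (A i) := by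
  ext i j
  simp [Matrix.mul_apply, PiLp.inner_apply, mul_comm]

theorem norm_sq_pinv_eq_sum_gram_inv {m n : Type*} [Fintype m] [Fintype n] [DecidableEq m]
    {A : Matrix m n ℝ} (hA : LinearIndependent ℝ fun i => WithLp.toLp 2 (A i)) :
    ‖pinv A‖ ^ 2 = ∑ i, (Matrix.gram ℝ fun i => WithLp.toLp 2 (A i))⁻¹ i i := by
  rw [← mul_transpose_eq_gram, norm_sq_pinv_eq_trace]
  · rfl
  · rw [mul_transpose_eq_gram]
    exact (Matrix.det_gram_ne_zero_iff_linearIndependent.2 hA).isUnit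

theorem map_uncurry_pi_pi {m n X : Type*} [Fintype m] [Fintype n] [MeasurableSpace X]
    (μ : Measure X) [SigmaFinite μ] :
    (Measure.pi fun _ : m => Measure.pi fun _ : n => μ).map Function.uncurry
      = Measure.pi fun _ : m × n => μ := by
  refine (Measure.pi_eq fun s hs => ?_).symm
  rw [Measure.map_apply measurable_uncurry (.univ_pi hs)]
  have : (Function.uncurry ⁻¹' Set.univ.pi s : Set (m → n → X))
      = Set.univ.pi fun i => Set.univ.pi fun j => s (i, j) := by
    ext; simp [Set.mem_pi]
  rw [this]
  simp [Measure.pi_pi, Fintype.prod_prod_type]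

/-! ### Gaussian matrices. -/

section

variable {Ω : Type*} [MeasurableSpace Ω] {P : Measure Ω}

theorem IsGaussianMatrix.inv_sqrt_smul {m n : Type*} {α : ℝ≥0} (hα : 0 < α)
    {G : Ω → Matrix m n ℝ} (hG : IsGaussianMatrix P α G) :
    IsGaussianMatrix P 1 fun ω => (√(α : ℝ))⁻¹ • G ω where
  hasLaw i j := by
    have h := gaussianReal_const_mul (hG.hasLaw i j) (√(α : ℝ))⁻¹
    convert h using 2
    · simp
    · simp
    · have : (α : ℝ) ≠ 0 := by exact_mod_cast hα.ne'
      refine NNReal.eq ?_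
      simp [this]
  indep := hG.indep.comp (fun _ x => (√(α : ℝ))⁻¹ * x) fun _ => by fun_prop

theorem IsGaussianMatrix.hasLaw_rows {m n : Type*} [Fintype m] [Fintype n]
    {Z : Ω → Matrix m n ℝ} (hZ : IsGaussianMatrix P 1 Z) :
    HasLaw (fun ω i => WithLp.toLp 2 (Z ω i))
      (Measure.pi fun _ : m => stdGaussian (EuclideanSpace ℝ n)) P := by
  have h := hZ.indep.hasLaw_pi fun ij : m × n => hZ.hasLaw ij.1 ij.2
  rw [← map_uncurry_pi_pi] at h
  have hm : Measurable fun (f : m × n → ℝ) (i : m) => WithLp.toLp 2 fun j => f (i, j) := by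
    fun_prop
  refine HasLaw.comp (X := fun ω (ij : m × n) => Z ω ij.1 ij.2)
    (Y := fun (f : m × n → ℝ) (i : m) => WithLp.toLp 2 fun j => f (i, j)) ⟨hm.aemeasurable, ?_⟩ h
  rw [Measure.map_map hm measurable_uncurry, ← map_pi_eq_stdGaussian]
  have hp : IsProbabilityMeasure ((Measure.pi fun _ : n => gaussianReal 0 1).map (WithLp.toLp 2)) :=
    Measure.isProbabilityMeasure_map (by fun_prop)
  exact Measure.pi_map_pi (fun _ => by fun_prop)

theorem IsGaussianMatrix.integrable_norm_sq_pinv_and_integral_eq {k p : ℕ} (hp : 2 ≤ p)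
    {Z : Ω → Matrix (Fin k) (Fin (k + p)) ℝ} (hZ : IsGaussianMatrix P 1 Z) :
    Integrable (fun ω => ‖pinv (Z ω)‖ ^ 2) P ∧
      ∫ ω, ‖pinv (Z ω)‖ ^ 2 ∂P = (k : ℝ) / ((p : ℝ) - 1) := by
  have hE : Module.finrank ℝ (EuclideanSpace ℝ (Fin (k + p))) = k + p := by simp
  have hp1 : (0 : ℝ) ≤ 1 / ((p : ℝ) - 1) := by
    have : (2 : ℝ) ≤ p := by exact_mod_cast hp
    exact one_div_nonneg.2 (by linarith)
  have hlaw := hZ.hasLaw_rows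
  set R : Ω → Fin k → EuclideanSpace ℝ (Fin (k + p)) := fun ω i => WithLp.toLp 2 (Z ω i) with hR
  have hRm : AEMeasurable R P := hlaw.aemeasurable
  have hli : ∀ᵐ ω ∂P, LinearIndependent ℝ (R ω) := by
    have := ae_linearIndependent_pi_stdGaussian hp hE
    rw [← hlaw.map_eq] at this
    exact ae_of_ae_map hRm this
  have hnorm : (fun ω => ‖pinv (Z ω)‖ ^ 2) =ᵐ[P] fun ω => ∑ i, (Matrix.gram ℝ (R ω))⁻¹ i i := by
    filter_upwards [hli] with ω hω using norm_sq_pinv_eq_sum_gram_inv hω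
  -- This holds for every `ω`, since a singular matrix has inverse `0` by convention. Nonnegativity
  -- lets the finite `∫⁻` yield integrability.
  have hnonneg : ∀ (i : Fin k) ω, 0 ≤ (Matrix.gram ℝ (R ω))⁻¹ i i := fun i ω =>
    ((Matrix.posSemidef_gram ℝ (R ω)).inv).diag_nonneg
  have hlint : ∀ i, ∫⁻ ω, ENNReal.ofReal ((Matrix.gram ℝ (R ω))⁻¹ i i) ∂P
      = ENNReal.ofReal (1 / ((p : ℝ) - 1)) := by
    intro i
    rw [← lintegral_gram_inv_apply_self hp hE i, ← hlaw.map_eq, lintegral_map'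
      (measurable_gram_inv_apply i i).ennreal_ofReal.aemeasurable hRm]
  have hsm : ∀ i, AEStronglyMeasurable (fun ω => (Matrix.gram ℝ (R ω))⁻¹ i i) P := fun i =>
    ((measurable_gram_inv_apply i i).comp_aemeasurable hRm).aestronglyMeasurable
  have hint : ∀ i, Integrable (fun ω => (Matrix.gram ℝ (R ω))⁻¹ i i) P := fun i =>
    (lintegral_ofReal_ne_top_iff_integrable (hsm i) (.of_forall (hnonneg i))).1
      (by rw [hlint]; exact ENNReal.ofReal_ne_top)
  have hval : ∀ i, ∫ ω, (Matrix.gram ℝ (R ω))⁻¹ i i ∂P = 1 / ((p : ℝ) - 1) := fun i => by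
    rw [integral_eq_lintegral_of_nonneg_ae (.of_forall (hnonneg i)) (hsm i), hlint,
      ENNReal.toReal_ofReal hp1]
  refine ⟨(integrable_finsetSum _ fun i _ => hint i).congr hnorm.symm, ?_⟩
  rw [integral_congr_ae hnorm, integral_finsetSum _ fun i _ => hint i]
  simp [hval, div_eq_mul_inv]

end

/-- The matrix of real entries `G ω` is viewed as a matrix over `𝕜 = ℝ` or `𝕜 = ℂ`, and `‖·‖` is the
Frobenius norm. -/
theorem mainTheorem2 {𝕜 : Type*} [RCLike 𝕜] (k p : ℕ) (hp : 2 ≤ p) (α : ℝ≥0) (hα : 0 < α)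
    {Ω : Type*} [MeasurableSpace Ω] (P : Measure Ω) [IsProbabilityMeasure P]
    (G : Ω → Matrix (Fin k) (Fin (k + p)) ℝ) (hG : IsGaussianMatrix P α G) :
    Integrable (fun ω => ‖pinv ((G ω).map (algebraMap ℝ 𝕜))‖ ^ 2) P ∧
      ∫ ω, ‖pinv ((G ω).map (algebraMap ℝ 𝕜))‖ ^ 2 ∂P
        = (k : ℝ) / ((p : ℝ) - 1) * (α : ℝ)⁻¹ := by
  obtain ⟨hint, hval⟩ := (hG.inv_sqrt_smul hα).integrable_norm_sq_pinv_and_integral_eq hp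
  have hα' : (0 : ℝ) < α := hα
  have hs : (√(α : ℝ))⁻¹ ≠ 0 := by positivity
  have h : ∀ ω, ‖pinv ((G ω).map (algebraMap ℝ 𝕜))‖ ^ 2
      = ‖pinv ((√(α : ℝ))⁻¹ • G ω)‖ ^ 2 * (α : ℝ)⁻¹ := fun ω => by
    rw [norm_pinv_map_algebraMap, pinv_smul hs, norm_smul, mul_pow, inv_inv, Real.norm_eq_abs,
      sq_abs, Real.sq_sqrt hα'.le]
    field_simp
  simp only [h]
  exact ⟨hint.mul_const _, by rw [integral_mul_const, hval]⟩
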